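/- Let $K$ be an algebraically closed field of characteristic $0$, let $n\ge 0$, and let $R=K[x_0,\dots,x_n]/(g_0,\dots,g_n)$, where $g_0,\dots,g_n$ is a regular sequence of homogeneous polynomials of degree $2$ (a complete intersection standard Artinian Gorenstein algebra of codimension $n+1$ presented by quadrics), with its standard grading $R=\bigoplus_{d\ge 0}R^d$. Let $$\mathcal N_2=\{[x]\in\mathbb P(R^1)\mid x^2=0\}.$$ If $t_1,\dots,t_k\in R^1\setminus\{0\}$ are such that $[t_1],\dots,[t_k]$ are distinct points of $\mathcal N_2$, then $t_1\cdots t_k\neq 0$ in $R$ and $t_1,\dots,t_k$ are linearly independent over $K$, i.e. the points $[t_1],\dots,[t_k]$ are in general position in $\mathbb P(R^1)$. In particular, $\mathcal N_2$ is finite and $\#\mathcal N_2\le n+1=N$, where $N$ is the socle degree of $R$, i.e. the largest $d$ with $R^d\neq 0$. -/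

import Mathlib

/-- The graded `K`-algebra `R = ⨁ 𝒜 i` is a complete intersection standard Artinian Gorenstein
algebra presented by forms of degree `e` in `n + 1` variables: as a graded algebra it is
`K[x₀, …, xₙ] / (g₀, …, gₙ)`, where `g₀, …, gₙ` is a regular sequence of forms of degree `e`.
(Such a quotient is automatically standard, Artinian and Gorenstein, and its codimension is
`n + 1` when `2 ≤ e`.) -/
def IsCompleteIntersectionSAGA {K R : Type*} [Field K] [CommRing R] [Algebra K R]
    (𝒜 : ℕ → Submodule K R) (n e : ℕ) : Prop :=
  ∃ (g : Fin (n + 1) → MvPolynomial (Fin (n + 1)) K)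
    (φ : MvPolynomial (Fin (n + 1)) K →ₐ[K] R),
    (∀ i, (g i).IsHomogeneous e) ∧
    RingTheory.Sequence.IsRegular (MvPolynomial (Fin (n + 1)) K) (List.ofFn g) ∧
    Function.Surjective φ ∧
    RingHom.ker φ = Ideal.span (Set.range g) ∧
    ∀ d, 𝒜 d = (MvPolynomial.homogeneousSubmodule (Fin (n + 1)) K d).map φ.toLinearMap

/-- `N` is the socle degree of the graded algebra `R = ⨁ 𝒜 i`: the last degree in which `R` does
not vanish. -/
def IsSocleDegree {K R : Type*} [Field K] [CommRing R] [Algebra K R]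
    (𝒜 : ℕ → Submodule K R) (N : ℕ) : Prop :=
  𝒜 N ≠ ⊥ ∧ ∀ d, N < d → 𝒜 d = ⊥

/-- The nilpotent locus `{[x] ∈ ℙ(R^a) | x ^ k = 0}`. -/
def nilpotentLocus {K R : Type*} [Field K] [CommRing R] [Algebra K R]
    (𝒜 : ℕ → Submodule K R) (a k : ℕ) : Set (Projectivization K (𝒜 a)) :=
  {p | (p.rep : R) ^ k = 0}

/-- Membership in the nilpotent locus does not depend on the representative. -/
theorem mk_mem_nilpotentLocus {K R : Type*} [Field K] [CommRing R] [Algebra K R]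
    (𝒜 : ℕ → Submodule K R) (a k : ℕ) (x : 𝒜 a) (hx : x ≠ 0) :
    Projectivization.mk K x hx ∈ nilpotentLocus 𝒜 a k ↔ (x : R) ^ k = 0 := by
  obtain ⟨c, hc⟩ := Projectivization.exists_smul_eq_mk_rep K x hx
  have h : ((Projectivization.mk K x hx).rep : R) = (c : K) • (x : R) := by
    rw [← hc]; rfl
  show ((Projectivization.mk K x hx).rep : R) ^ k = 0 ↔ _
  rw [h, smul_pow, smul_eq_zero]
  simp

/-!
Write `A` for the polynomial ring. The product statement is proved, by induction on the number of
points, for an ideal `(l, g)` generated by a regular sequence of linear forms `l` and quadrics `g`,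
and for linear forms `t₁, …, tₖ` which are pairwise independent modulo `l` and have their squares
in `(l, g)` (`MvPolynomial.prod_notMem_ofList`). Put `p = t₁`. By degree, `p ^ 2` is modulo `(l)` a
`K`-linear combination of the quadrics, and it is not in `(l)`. So it can be exchanged for some
quadric `f` in `g`. As regular sequences of forms of positive degree may be permuted
(`MvPolynomial.isRegularModulo_perm`), `f` may be taken last; then `p ^ 2`, and with it `p`, is a
nonzerodivisor modulo the other members, `p` can replace `f` in the regular sequence, and
`(l, g) : p = (p, l, g \ f)` (`MvPolynomial.exists_exchange`). So `p t₂ ⋯ tₖ ∈ (l, g)` would force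
`t₂ ⋯ tₖ ∈ (p, l, g \ f)`. The forms `t₂, …, tₖ` are still pairwise independent modulo `p, l`:
squaring a relation `r = b q + a p` would put `2 a b p q` into `(l, g)`, hence `q` into
`(p, l, g \ f)`, and so into the span of `p, l`.

Linear independence follows: multiplying a relation `∑ cⱼ tⱼ = 0` by the product of the `tⱼ` with
`j ≠ i` leaves `cᵢ t₁ ⋯ tₖ = 0`.

For the socle degree, multiplication by a nonzerodivisor of degree `e` multiplies the Hilbert series
of the quotient by `1 - X ^ e` (`MvPolynomial.quotientHilbertSeries_sup_span`). The Hilbert series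
of `R` is therefore `(1 - X ^ 2) ^ (n + 1) / (1 - X) ^ (n + 1) = (1 + X) ^ (n + 1)`, of degree
`n + 1`. Finally, `n + 2` points of the nilpotent locus would have a nonzero product in
degree `n + 2`, where `R` vanishes.
-/

/-! ### Regular sequences of forms -/

section RegularSequence

/-- `L` is a regular sequence on `A ⧸ I`, expressed through ideals of `A`: each member is a
nonzerodivisor modulo `I` and the members before it. As for `RingTheory.Sequence.IsWeaklyRegular`,
the quotient is allowed to vanish. -/
def IsRegularModulo {A : Type*} [CommRing A] : Ideal A → List A → Prop
  | _, [] => True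
  | I, f :: L => (∀ x, f * x ∈ I → x ∈ I) ∧ IsRegularModulo (I ⊔ Ideal.span {f}) L

variable {A : Type*} [CommRing A]

theorem isRegularModulo_append {I : Ideal A} {L₁ L₂ : List A} :
    IsRegularModulo I (L₁ ++ L₂) ↔
      IsRegularModulo I L₁ ∧ IsRegularModulo (I ⊔ Ideal.ofList L₁) L₂ := by
  induction L₁ generalizing I with
  | nil => simp [IsRegularModulo]
  | cons f L ih => simp only [List.cons_append, IsRegularModulo, ih, Ideal.ofList_cons, and_assoc,
      sup_assoc]

theorem isRegularModulo_of_getElem {I : Ideal A} {L : List A}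
    (h : ∀ (i : ℕ) (hi : i < L.length) (x : A),
      L[i] * x ∈ I ⊔ Ideal.ofList (L.take i) → x ∈ I ⊔ Ideal.ofList (L.take i)) :
    IsRegularModulo I L := by
  induction L generalizing I with
  | nil => trivial
  | cons f L ih =>
    refine ⟨fun x hx => ?_, ih fun i hi x hx => ?_⟩
    · simpa using h 0 (by simp) x (by simpa using hx)
    · have := h (i + 1) (by simpa using hi) x
      simp only [List.getElem_cons_succ, List.take_succ_cons, Ideal.ofList_cons,
        ← sup_assoc] at this
      exact this hx

theorem RingTheory.Sequence.IsWeaklyRegular.isRegularModulo {L : List A}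
    (h : RingTheory.Sequence.IsWeaklyRegular A L) : IsRegularModulo ⊥ L := by
  refine isRegularModulo_of_getElem fun i hi x hx => ?_
  have hreg := h.regular_mod_prev i hi
  rw [bot_sup_eq] at hx ⊢
  rw [smul_eq_mul, Ideal.mul_top] at hreg
  have := hreg.right_eq_zero_of_smul (x := Ideal.Quotient.mk _ x)
  rw [← Ideal.Quotient.eq_zero_iff_mem]
  refine this ?_
  rw [← Ideal.Quotient.eq_zero_iff_mem] at hx
  exact hx

theorem Ideal.ofList_perm {L L' : List A} (h : L.Perm L') : Ideal.ofList L = Ideal.ofList L' := by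
  unfold Ideal.ofList
  congr 1
  ext r
  exact h.mem_iff

theorem Ideal.ofList_ofFn {n : ℕ} (g : Fin n → A) :
    Ideal.ofList (List.ofFn g) = Ideal.span (Set.range g) := by
  unfold Ideal.ofList
  congr 1
  ext r
  exact List.mem_ofFn

end RegularSequence

namespace MvPolynomial

section Components

variable {σ K : Type*} [CommRing K]

attribute [local instance] MvPolynomial.gradedAlgebra

theorem coe_decompose_homogeneousSubmodule (p : MvPolynomial σ K) (d : ℕ) :
    (DirectSum.decompose (homogeneousSubmodule σ K) p d : MvPolynomial σ K) =
      homogeneousComponent d p :=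
  decomposition.decompose'_apply p d

theorem homogeneousComponent_mul_of_lt {a : MvPolynomial σ K} {e d : ℕ} (ha : a.IsHomogeneous e)
    (b : MvPolynomial σ K) (h : d < e) : homogeneousComponent d (a * b) = 0 := by
  rw [← coe_decompose_homogeneousSubmodule]
  exact DirectSum.coe_decompose_mul_of_left_mem_of_not_le (homogeneousSubmodule σ K) ha h.not_ge

theorem homogeneousComponent_mul_add {a : MvPolynomial σ K} {e : ℕ} (ha : a.IsHomogeneous e)
    (b : MvPolynomial σ K) (d : ℕ) :
    homogeneousComponent (e + d) (a * b) = a * homogeneousComponent d b := by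
  rw [← coe_decompose_homogeneousSubmodule, ← coe_decompose_homogeneousSubmodule]
  exact DirectSum.coe_decompose_mul_add_of_left_mem (homogeneousSubmodule σ K) ha

theorem isHomogeneous_ofList {L : List (MvPolynomial σ K)}
    (hL : ∀ f ∈ L, ∃ e, 0 < e ∧ f.IsHomogeneous e) :
    (Ideal.ofList L).IsHomogeneous (homogeneousSubmodule σ K) :=
  Ideal.homogeneous_span _ _ fun f hf => let ⟨e, _, he⟩ := hL f hf; ⟨e, he⟩

/-- Nakayama's lemma for the ideal `(I : b)`, which is contained in `I + a (I : b)` as soon as `b`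
is a nonzerodivisor modulo `I + (a)` and `a` is one modulo `I`. -/
theorem mem_of_mul_mem_of_regular {I : Ideal (MvPolynomial σ K)}
    (hI : I.IsHomogeneous (homogeneousSubmodule σ K)) {a b : MvPolynomial σ K} {e : ℕ} (he : 0 < e)
    (ha : a.IsHomogeneous e) (hreg : ∀ x, a * x ∈ I → x ∈ I)
    (hreg' : ∀ x, b * x ∈ I ⊔ Ideal.span {a} → x ∈ I ⊔ Ideal.span {a})
    {x : MvPolynomial σ K} (hx : b * x ∈ I) : x ∈ I := by
  have key : ∀ k : ℕ, ∀ x, b * x ∈ I → ∃ y, x - a ^ k * y ∈ I := by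
    intro k
    induction k with
    | zero => exact fun x _ => ⟨x, by simp⟩
    | succ k ih =>
      intro x hx
      obtain ⟨i, hi, w, hw, rfl⟩ := Submodule.mem_sup.mp (hreg' x (Ideal.mem_sup_left hx))
      obtain ⟨y, rfl⟩ := Ideal.mem_span_singleton'.mp hw
      have hy : b * y ∈ I := by
        refine hreg _ ?_
        have : a * (b * y) = b * (i + y * a) - b * i := by ring
        rw [this]
        exact I.sub_mem hx (I.mul_mem_left _ hi)
      obtain ⟨z, hz⟩ := ih y hy
      refine ⟨z, ?_⟩
      have : i + y * a - a ^ (k + 1) * z = i + a * (y - a ^ k * z) := by ring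
      rw [this]
      exact I.add_mem hi (I.mul_mem_left _ hz)
  rw [mem_iff_homogeneousComponent_mem hI]
  intro d
  obtain ⟨y, hy⟩ := key (d + 1) x hx
  have h := homogeneousComponent_mem_of_mem hI hy d
  rwa [map_sub, homogeneousComponent_mul_of_lt (ha.pow (d + 1)) y, sub_zero] at h
  nlinarith

/-- Homogeneous regular sequences of positive degree may be permuted. -/
theorem isRegularModulo_perm {L L' : List (MvPolynomial σ K)} (h : L.Perm L')
    (hL : ∀ f ∈ L, ∃ e, 0 < e ∧ f.IsHomogeneous e) {I : Ideal (MvPolynomial σ K)}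
    (hI : I.IsHomogeneous (homogeneousSubmodule σ K)) (hreg : IsRegularModulo I L) :
    IsRegularModulo I L' := by
  induction h generalizing I with
  | nil => trivial
  | cons f _ ih =>
    refine ⟨hreg.1, ih (fun g hg => hL g (by simp [hg])) (hI.sup ?_) hreg.2⟩
    obtain ⟨e, _, he⟩ := hL f (by simp)
    exact Ideal.homogeneous_span _ _ fun g hg => ⟨e, by rwa [Set.mem_singleton_iff.mp hg]⟩
  | swap a b l =>
    obtain ⟨h₁, h₂, h₃⟩ := hreg
    obtain ⟨e, he, hb⟩ := hL b (by simp)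
    have h₁' : ∀ x, a * x ∈ I → x ∈ I := fun x =>
      mem_of_mul_mem_of_regular hI he hb h₁ h₂
    refine ⟨h₁', fun x hx => ?_, by rwa [sup_right_comm]⟩
    obtain ⟨i, hi, w, hw, hxw⟩ := Submodule.mem_sup.mp hx
    obtain ⟨y, rfl⟩ := Ideal.mem_span_singleton'.mp hw
    have hy : y ∈ I ⊔ Ideal.span {b} := by
      refine h₂ y ?_
      have : a * y = -i + b * x := by rw [← hxw]; ring
      rw [this]
      exact Ideal.add_mem _ (Ideal.mem_sup_left (I.neg_mem hi))
        (Ideal.mem_sup_right (Ideal.mul_mem_right _ _ (Ideal.mem_span_singleton_self b)))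
    obtain ⟨j, hj, v, hv, rfl⟩ := Submodule.mem_sup.mp hy
    obtain ⟨z, rfl⟩ := Ideal.mem_span_singleton'.mp hv
    have hz : x - z * a ∈ I := by
      refine h₁ _ ?_
      have : b * (x - z * a) = i + a * j := by linear_combination -hxw
      rw [this]
      exact I.add_mem hi (I.mul_mem_left _ hj)
    have : x = (x - z * a) + z * a := by ring
    rw [this]
    exact Ideal.add_mem _ (Ideal.mem_sup_left hz)
      (Ideal.mem_sup_right (Ideal.mul_mem_left _ _ (Ideal.mem_span_singleton_self a)))
  | trans h₁₂ _ ih₁ ih₂ =>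
    exact ih₂ (fun f hf => hL f (h₁₂.mem_iff.mpr hf)) hI (ih₁ hL hI hreg)

end Components

end MvPolynomial

/-! ### Products of linear forms with square zero -/

namespace MvPolynomial

section Forms

variable {σ K : Type*} [CommRing K]

attribute [local instance] MvPolynomial.gradedAlgebra

theorem homogeneousComponent_mem_span {G : Set (MvPolynomial σ K)} {e : ℕ}
    (hG : ∀ g ∈ G, g.IsHomogeneous e) {w : MvPolynomial σ K} (hw : w ∈ Ideal.span G) :
    homogeneousComponent e w ∈ Submodule.span K G := by
  induction hw using Submodule.closure_induction with
  | zero => simp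
  | add x y _ _ hx hy => rw [map_add]; exact add_mem hx hy
  | smul_mem r x hx =>
    have h := homogeneousComponent_mul_add (hG x hx) r 0
    rw [add_zero, homogeneousComponent_zero] at h
    rw [smul_eq_mul, mul_comm, h, mul_comm, ← smul_eq_C_mul]
    exact Submodule.smul_mem _ _ (Submodule.subset_span hx)

theorem homogeneousComponent_eq_zero_of_mem_span {G : Set (MvPolynomial σ K)} {e d : ℕ}
    (hG : ∀ g ∈ G, g.IsHomogeneous e) (hd : d < e) {w : MvPolynomial σ K}
    (hw : w ∈ Ideal.span G) : homogeneousComponent d w = 0 := by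
  induction hw using Submodule.closure_induction with
  | zero => simp
  | add x y _ _ hx hy => rw [map_add, hx, hy, add_zero]
  | smul_mem r x hx => rw [smul_eq_mul, mul_comm, homogeneousComponent_mul_of_lt (hG x hx) r hd]

theorem exists_mem_span_sub_mem {I : Ideal (MvPolynomial σ K)}
    (hI : I.IsHomogeneous (homogeneousSubmodule σ K)) {G : Set (MvPolynomial σ K)} {e : ℕ}
    (hG : ∀ g ∈ G, g.IsHomogeneous e) {q : MvPolynomial σ K} (hq : q.IsHomogeneous e)
    (hqI : q ∈ I ⊔ Ideal.span G) : ∃ s ∈ Submodule.span K G, q - s ∈ I := by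
  obtain ⟨i, hi, w, hw, rfl⟩ := Submodule.mem_sup.mp hqI
  refine ⟨_, homogeneousComponent_mem_span hG hw, ?_⟩
  have h := homogeneousComponent_mem_of_mem hI hi e
  rw [← homogeneousComponent_eq_self hq, map_add, add_sub_cancel_right]
  exact h

/-- A linear form in an ideal generated by linear forms `l` and by quadrics `g` is a linear
combination of the members of `l`. -/
theorem mem_span_of_mem_ofList_append {l g : List (MvPolynomial σ K)}
    (hl : ∀ f ∈ l, f.IsHomogeneous 1) (hg : ∀ f ∈ g, f.IsHomogeneous 2) {q : MvPolynomial σ K}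
    (hq : q.IsHomogeneous 1) (hqI : q ∈ Ideal.ofList (l ++ g)) :
    q ∈ Submodule.span K {f | f ∈ l} := by
  rw [Ideal.ofList_append] at hqI
  obtain ⟨i, hi, w, hw, rfl⟩ := Submodule.mem_sup.mp hqI
  rw [← homogeneousComponent_eq_self hq, map_add,
    homogeneousComponent_eq_zero_of_mem_span hg one_lt_two hw, add_zero]
  exact homogeneousComponent_mem_span hl hi

theorem exists_perm_cons_of_mem_span {J : Ideal (MvPolynomial σ K)} {g : List (MvPolynomial σ K)}
    {s : MvPolynomial σ K} (hs : s ∈ Submodule.span K {f | f ∈ g}) (hsJ : s ∉ J) :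
    ∃ f g', g.Perm (f :: g') ∧ ∃ c : K, c ≠ 0 ∧ s - c • f ∈ J ⊔ Ideal.ofList g' := by
  induction g generalizing s with
  | nil => simp_all
  | cons a g ih =>
    have : {f | f ∈ a :: g} = insert a {f | f ∈ g} := by ext; simp
    rw [this] at hs
    obtain ⟨c, r, hr, rfl⟩ := Submodule.mem_span_insert.mp hs
    by_cases hc : c = 0
    · subst hc
      rw [zero_smul, zero_add] at hsJ ⊢
      obtain ⟨f, g', hp, c, hc, h⟩ := ih hr hsJ
      refine ⟨f, a :: g', (hp.cons a).trans (.swap _ _ _), c, hc, ?_⟩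
      rw [Ideal.ofList_cons]
      exact sup_le_sup_left le_sup_right J h
    · refine ⟨a, g, .refl _, c, hc, Ideal.mem_sup_right ?_⟩
      rw [add_sub_cancel_left]
      exact Submodule.span_le_restrictScalars K (MvPolynomial σ K) _ hr

end Forms

section SquareZero

variable {σ K : Type*} [Field K]

attribute [local instance] MvPolynomial.gradedAlgebra

/-- Linear forms cut out a reduced scheme: evaluate at a point where the members of `l` vanish
and `p` does not. -/
theorem sq_notMem_ofList {l : List (MvPolynomial σ K)} (hl : ∀ f ∈ l, f.IsHomogeneous 1)
    {p : MvPolynomial σ K} (hp : p.IsHomogeneous 1) (hpl : p ∉ Submodule.span K {f | f ∈ l}) :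
    p ^ 2 ∉ Ideal.ofList l := by
  obtain ⟨φ, hφp, hφl⟩ := Submodule.exists_le_ker_of_notMem hpl
  have heval : ∀ f : MvPolynomial σ K, f.IsHomogeneous 1 → aeval (fun i => φ (X i)) f = φ f := by
    intro f hf
    rw [← mem_homogeneousSubmodule, homogeneousSubmodule_one_eq_span_X] at hf
    induction hf using Submodule.span_induction with
    | mem x hx => obtain ⟨i, rfl⟩ := hx; simp
    | zero => simp
    | add x y _ _ hx hy => rw [map_add, map_add, hx, hy]
    | smul c x _ hx => rw [map_smul, map_smul, hx]
  intro hmem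
  have hle : Ideal.ofList l ≤ RingHom.ker (aeval (R := K) (fun i => φ (X (R := K) i))) := by
    refine Ideal.span_le.mpr fun f hf => ?_
    rw [SetLike.mem_coe, RingHom.mem_ker]
    exact (heval f (hl f hf)).trans (hφl (Submodule.subset_span hf))
  have h := hle hmem
  rw [RingHom.mem_ker, map_pow, heval p hp] at h
  exact hφp (pow_eq_zero_iff two_ne_zero |>.mp h)

/-- If `p` is a linear form, independent of the linear forms `l`, whose square lies in the ideal
of a regular sequence `l, g` with `g` consisting of quadrics, then one of the quadrics can be
exchanged for `p ^ 2`. Hence `p` itself can replace that quadric, and the new ideal is the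
annihilator of `p` modulo the old one. -/
theorem exists_exchange {l g : List (MvPolynomial σ K)}
    (hl : ∀ f ∈ l, f.IsHomogeneous 1) (hg : ∀ f ∈ g, f.IsHomogeneous 2)
    (hreg : IsRegularModulo ⊥ (l ++ g)) {p : MvPolynomial σ K} (hp : p.IsHomogeneous 1)
    (hpl : p ∉ Submodule.span K {f | f ∈ l}) (hpI : p ^ 2 ∈ Ideal.ofList (l ++ g)) :
    ∃ g' : List (MvPolynomial σ K), g' ⊆ g ∧ IsRegularModulo ⊥ (p :: l ++ g') ∧
      Ideal.ofList (l ++ g) ≤ Ideal.ofList (p :: l ++ g') ∧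
      ∀ x, p * x ∈ Ideal.ofList (l ++ g) → x ∈ Ideal.ofList (p :: l ++ g') := by
  have hpos : ∀ f ∈ l ++ g, ∃ e, 0 < e ∧ f.IsHomogeneous e := by
    intro f hf
    rcases List.mem_append.mp hf with h | h
    · exact ⟨1, one_pos, hl f h⟩
    · exact ⟨2, two_pos, hg f h⟩
  have hlhom : (Ideal.ofList l).IsHomogeneous (homogeneousSubmodule σ K) :=
    isHomogeneous_ofList fun f hf => hpos f (List.mem_append_left _ hf)
  rw [Ideal.ofList_append] at hpI
  obtain ⟨s, hs, hps⟩ := exists_mem_span_sub_mem hlhom hg (hp.pow 2) hpI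
  have hsl : s ∉ Ideal.ofList l := fun h =>
    sq_notMem_ofList hl hp hpl (by simpa using Ideal.add_mem _ hps h)
  obtain ⟨f, g', hperm, c, hc, hsf⟩ := exists_perm_cons_of_mem_span hs hsl
  have hperm' : (l ++ g).Perm (l ++ g' ++ [f]) :=
    (hperm.append_left l).trans (by
      rw [List.append_assoc]
      exact (List.perm_append_comm (l₁ := [f]) (l₂ := g')).append_left l)
  set J := Ideal.ofList (l ++ g') with hJ
  -- modulo `J`, the square of `p` is a nonzero multiple of the quadric `f`
  have hpf : p ^ 2 - c • f ∈ J := by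
    rw [hJ, Ideal.ofList_append]
    simpa using Ideal.add_mem _ (Ideal.mem_sup_left hps) hsf
  have hreg' := isRegularModulo_perm hperm' hpos (Ideal.IsHomogeneous.bot _) hreg
  obtain ⟨hregJ, hfreg⟩ := isRegularModulo_append.mp hreg'
  rw [bot_sup_eq] at hfreg
  have hpreg : ∀ x, p * x ∈ J → x ∈ J := by
    intro x hx
    refine hfreg.1 x ?_
    have : f * x = C c⁻¹ * (p * (p * x) - (p ^ 2 - c • f) * x) := by
      have hC : (C c⁻¹ : MvPolynomial σ K) * C c = 1 := by rw [← C_mul, inv_mul_cancel₀ hc, C_1]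
      rw [smul_eq_C_mul]
      linear_combination (-(f * x)) * hC
    rw [this]
    exact J.mul_mem_left _ (J.sub_mem (J.mul_mem_left _ hx) (J.mul_mem_right _ hpf))
  have hI : Ideal.ofList (l ++ g) = J ⊔ Ideal.span {f} := by
    rw [Ideal.ofList_perm hperm', Ideal.ofList_append, Ideal.ofList_singleton]
  have hI' : Ideal.ofList (p :: l ++ g') = J ⊔ Ideal.span {p} := by
    rw [List.cons_append, Ideal.ofList_cons, sup_comm]
  have hsub : g' ⊆ g := fun x hx => hperm.mem_iff.mpr (List.mem_cons_of_mem _ hx)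
  have hfp : ∃ j ∈ J, f = j + p * (C c⁻¹ * p) := by
    refine ⟨-(C c⁻¹ * (p ^ 2 - c • f)), J.neg_mem (J.mul_mem_left _ hpf), ?_⟩
    have hC : (C c⁻¹ : MvPolynomial σ K) * C c = 1 := by rw [← C_mul, inv_mul_cancel₀ hc, C_1]
    rw [smul_eq_C_mul]
    linear_combination (-f) * hC
  obtain ⟨j, hj, hfj⟩ := hfp
  refine ⟨g', hsub, ?_, ?_, ?_⟩
  · refine isRegularModulo_perm (L := l ++ g' ++ [p]) List.perm_append_comm ?_
      (Ideal.IsHomogeneous.bot _) (isRegularModulo_append.mpr ⟨hregJ, ?_⟩)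
    · intro x hx
      rcases List.mem_append.mp hx with h | h
      · exact hpos x (by
          rcases List.mem_append.mp h with h | h
          · exact List.mem_append_left _ h
          · exact List.mem_append_right _ (hsub h))
      · exact ⟨1, one_pos, by rwa [List.mem_singleton.mp h]⟩
    · rw [bot_sup_eq]
      exact ⟨hpreg, trivial⟩
  · rw [hI, hI']
    refine sup_le le_sup_left ?_
    rw [Ideal.span_singleton_le_iff_mem, hfj]
    exact Ideal.add_mem _ (Ideal.mem_sup_left hj)
      (Ideal.mem_sup_right (Ideal.mul_mem_right _ _ (Ideal.mem_span_singleton_self p)))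
  · intro x hx
    rw [hI] at hx
    rw [hI']
    obtain ⟨i, hi, w, hw, hxw⟩ := Submodule.mem_sup.mp hx
    obtain ⟨y, rfl⟩ := Ideal.mem_span_singleton'.mp hw
    have h : x - C c⁻¹ * p * y ∈ J := by
      refine hpreg _ ?_
      have : p * (x - C c⁻¹ * p * y) = i + y * j := by
        linear_combination -hxw + y * hfj
      rw [this]
      exact J.add_mem hi (J.mul_mem_left _ hj)
    have : x = (x - C c⁻¹ * p * y) + p * (C c⁻¹ * y) := by ring
    rw [this]
    exact Ideal.add_mem _ (Ideal.mem_sup_left h)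
      (Ideal.mem_sup_right (Ideal.mul_mem_right _ _ (Ideal.mem_span_singleton_self p)))

/-- The product of linear forms with squares in the ideal of a regular sequence `l, g`, where `l`
consists of linear forms and `g` of quadrics, stays outside that ideal when the forms are pairwise
linearly independent modulo `l`. The forms behind the head `p` remain pairwise independent modulo
`p, l`: a relation `r = b q + a p` modulo `l` gives, on squaring, `2 a b p q = 0` modulo the ideal,
so that `q` lies in the annihilator of `p`. -/
theorem prod_notMem_ofList (h2 : (2 : K) ≠ 0) (t : List (MvPolynomial σ K)) :
    ∀ {l g : List (MvPolynomial σ K)}, (∀ f ∈ l, f.IsHomogeneous 1) →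
      (∀ f ∈ g, f.IsHomogeneous 2) → IsRegularModulo ⊥ (l ++ g) →
      (∀ q ∈ t, q.IsHomogeneous 1) → (∀ q ∈ t, q ∉ Submodule.span K {f | f ∈ l}) →
      t.Pairwise (fun p q => q ∉ Submodule.span K {f | f ∈ p :: l}) →
      (∀ q ∈ t, q ^ 2 ∈ Ideal.ofList (l ++ g)) → t.prod ∉ Ideal.ofList (l ++ g) := by
  induction t with
  | nil =>
    intro l g hl hg _ _ _ _ _ h1
    have : Ideal.ofList (l ++ g) ≤ RingHom.ker (constantCoeff (R := K) (σ := σ)) := by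
      refine Ideal.span_le.mpr fun f hf => ?_
      rw [SetLike.mem_coe, RingHom.mem_ker, constantCoeff_eq]
      rcases List.mem_append.mp hf with h | h
      · exact (hl f h).coeff_eq_zero (by simp)
      · exact (hg f h).coeff_eq_zero (by simp)
    have := this h1
    simp at this
  | cons p t ih =>
    intro l g hl hg hreg ht htl hpair hsq hmem
    have hp := ht p (by simp)
    obtain ⟨g', hsub, hreg', hle, hann⟩ :=
      exists_exchange hl hg hreg hp (htl p (by simp)) (hsq p (by simp))
    obtain ⟨hpt, hpair⟩ := List.pairwise_cons.mp hpair
    have hl' : ∀ f ∈ p :: l, f.IsHomogeneous 1 := by simpa using ⟨hp, hl⟩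
    have hg' : ∀ f ∈ g', f.IsHomogeneous 2 := fun f hf => hg f (hsub hf)
    refine ih hl' hg' hreg' (fun q hq => ht q (by simp [hq])) hpt ?_
      (fun q hq => hle (hsq q (by simp [hq]))) (hann _ (by simpa using hmem))
    refine (List.pairwise_iff_forall_sublist.mpr ?_)
    intro q r hqr hr
    have hq : q ∈ t := hqr.subset (by simp)
    have hrt : r ∈ t := hqr.subset (by simp)
    have hqr' := List.pairwise_iff_forall_sublist.mp hpair hqr
    have hins : ∀ (a : MvPolynomial σ K) (m : List (MvPolynomial σ K)),
        {f | f ∈ a :: m} = insert a {f | f ∈ m} := by intro a m; ext; simp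
    rw [hins] at hr
    obtain ⟨b, v, hv, hr⟩ := Submodule.mem_span_insert.mp hr
    have hv' := hv
    rw [hins] at hv'
    obtain ⟨a, u, hu, rfl⟩ := Submodule.mem_span_insert.mp hv'
    have hb : b ≠ 0 := by
      rintro rfl
      exact hpt r hrt (by rw [hr, zero_smul, zero_add]; exact hv)
    have ha : a ≠ 0 := by
      rintro rfl
      refine hqr' ?_
      rw [hr, zero_smul, zero_add, hins]
      exact Submodule.mem_span_insert.mpr ⟨b, u, hu, rfl⟩
    have huI : u ∈ Ideal.ofList (l ++ g) := by
      rw [Ideal.ofList_append]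
      exact Ideal.mem_sup_left (Submodule.span_le_restrictScalars K (MvPolynomial σ K) _ hu)
    set I := Ideal.ofList (l ++ g)
    have hpq : p * q ∈ I := by
      have hC : (C (2 * a * b)⁻¹ : MvPolynomial σ K) * (2 * C a * C b) = 1 := by
        have : (2 * C a * C b : MvPolynomial σ K) = C (2 * a * b) := by
          rw [C_mul, C_mul, map_ofNat]
        rw [this, ← C_mul, inv_mul_cancel₀ (mul_ne_zero (mul_ne_zero h2 ha) hb), C_1]
      have : p * q = C (2 * a * b)⁻¹ * (r ^ 2 - C b ^ 2 * q ^ 2 - C a ^ 2 * p ^ 2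
          - (u + 2 * (C b * q + C a * p)) * u) := by
        rw [hr, smul_eq_C_mul, smul_eq_C_mul]
        linear_combination (-(p * q)) * hC
      rw [this]
      refine I.mul_mem_left _ (I.sub_mem (I.sub_mem (I.sub_mem ?_ ?_) ?_) ?_)
      · exact hsq r (by simp [hrt])
      · exact I.mul_mem_left _ (hsq q (by simp [hq]))
      · exact I.mul_mem_left _ (hsq p (by simp))
      · exact I.mul_mem_left _ huI
    exact hpt q hq (mem_span_of_mem_ofList_append hl' hg' (ht q (by simp [hq])) (hann q hpq))

end SquareZero

end MvPolynomial

/-! ### Hilbert series of complete intersections -/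

namespace MvPolynomial

section Hilbert

variable {σ K : Type*} [Field K]

attribute [local instance] MvPolynomial.gradedAlgebra

/-- The Hilbert series `∑ dim (A ⧸ I)_d X ^ d` of a quotient of the polynomial ring `A` by a
homogeneous ideal `I`, with the dimension of `(A ⧸ I)_d` written as `dim A_d - dim I_d`. -/
noncomputable def quotientHilbertSeries (I : Ideal (MvPolynomial σ K)) : PowerSeries ℤ :=
  PowerSeries.mk fun d => (Module.finrank K (homogeneousSubmodule σ K d) : ℤ) -
    Module.finrank K ↥(homogeneousSubmodule σ K d ⊓ I.restrictScalars K)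

instance [Finite σ] (d : ℕ) : FiniteDimensional K (homogeneousSubmodule σ K d) :=
  Module.Finite.iff_fg.mpr (homogeneousSubmodule_fg σ K d)

theorem homogeneousSubmodule_inf_sup_span_of_lt {I : Ideal (MvPolynomial σ K)}
    (hI : I.IsHomogeneous (homogeneousSubmodule σ K)) {f : MvPolynomial σ K} {e d : ℕ}
    (hf : f.IsHomogeneous e) (hd : d < e) :
    homogeneousSubmodule σ K d ⊓ (I ⊔ Ideal.span {f}).restrictScalars K =
      homogeneousSubmodule σ K d ⊓ I.restrictScalars K := by
  refine le_antisymm (fun q hq => ⟨hq.1, ?_⟩)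
    (inf_le_inf_left _ fun x hx => Ideal.mem_sup_left hx)
  obtain ⟨hq, hqI⟩ := hq
  obtain ⟨i, hi, w, hw, rfl⟩ := Submodule.mem_sup.mp (show q ∈ I ⊔ Ideal.span {f} from hqI)
  have hw0 : homogeneousComponent d w = 0 :=
    homogeneousComponent_eq_zero_of_mem_span (by simpa using hf) hd hw
  change i + w ∈ I
  rw [← homogeneousComponent_eq_self hq, map_add, hw0, add_zero]
  exact homogeneousComponent_mem_of_mem hI hi d

/-- Multiplication by `f` gives `0 → (A ⧸ I)_d → (A ⧸ I)_(e + d) → (A ⧸ (I + (f)))_(e + d) → 0`. -/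
theorem finrank_homogeneousSubmodule_inf_sup_span [Finite σ] {I : Ideal (MvPolynomial σ K)}
    (hI : I.IsHomogeneous (homogeneousSubmodule σ K)) {f : MvPolynomial σ K} {e : ℕ}
    (hf : f.IsHomogeneous e) (hreg : ∀ x, f * x ∈ I → x ∈ I) (d : ℕ) :
    Module.finrank K ↥(homogeneousSubmodule σ K (e + d) ⊓
        (I ⊔ Ideal.span {f}).restrictScalars K) +
      Module.finrank K ↥(homogeneousSubmodule σ K d ⊓ I.restrictScalars K) =
    Module.finrank K ↥(homogeneousSubmodule σ K (e + d) ⊓ I.restrictScalars K) +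
      Module.finrank K (homogeneousSubmodule σ K d) := by
  set P := homogeneousSubmodule σ K (e + d) ⊓ I.restrictScalars K with hP
  set Q := homogeneousSubmodule σ K d ⊓ I.restrictScalars K with hQ
  have : FiniteDimensional K P := Submodule.finiteDimensional_inf_left _ _
  let Φ : (P × homogeneousSubmodule σ K d) →ₗ[K] MvPolynomial σ K :=
    LinearMap.coprod P.subtype (LinearMap.mulLeft K f ∘ₗ Submodule.subtype _)
  have hΦ : ∀ a s, Φ (a, s) = a + f * s := fun _ _ => rfl
  have hfP : ∀ s : Q, -(f * (s : MvPolynomial σ K)) ∈ P := fun s =>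
    P.neg_mem ⟨hf.mul s.2.1, I.mul_mem_left _ s.2.2⟩
  let Ψ : Q →ₗ[K] P × homogeneousSubmodule σ K d :=
    LinearMap.prod ((-(LinearMap.mulLeft K f ∘ₗ Q.subtype)).codRestrict P hfP)
      (Submodule.inclusion inf_le_left)
  have hrange : LinearMap.range Φ = homogeneousSubmodule σ K (e + d) ⊓
      (I ⊔ Ideal.span {f}).restrictScalars K := by
    ext q
    constructor
    · rintro ⟨⟨a, s⟩, rfl⟩
      rw [hΦ]
      exact ⟨add_mem a.2.1 (hf.mul s.2), Ideal.add_mem _ (Ideal.mem_sup_left a.2.2)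
        (Ideal.mem_sup_right (Ideal.mul_mem_right _ _ (Ideal.mem_span_singleton_self f)))⟩
    · rintro ⟨hq, hqI⟩
      obtain ⟨i, hi, w, hw, rfl⟩ := Submodule.mem_sup.mp (show q ∈ I ⊔ Ideal.span {f} from hqI)
      obtain ⟨y, rfl⟩ := Ideal.mem_span_singleton'.mp hw
      refine ⟨(⟨homogeneousComponent (e + d) i, homogeneousComponent_mem _ _,
        homogeneousComponent_mem_of_mem hI hi _⟩,
        ⟨homogeneousComponent d y, homogeneousComponent_mem _ _⟩), ?_⟩
      rw [hΦ]
      have := homogeneousComponent_eq_self hq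
      rw [map_add, mul_comm y f, homogeneousComponent_mul_add hf] at this
      rw [this, mul_comm y f]
  have hinj : Function.Injective Ψ := fun s t hst => by
    have := congrArg (fun z => (z.2 : MvPolynomial σ K)) hst
    exact Subtype.ext this
  have hker : LinearMap.range Ψ = LinearMap.ker Φ := by
    ext ⟨a, s⟩
    rw [LinearMap.mem_ker, hΦ]
    constructor
    · rintro ⟨s', hs'⟩
      obtain ⟨rfl, rfl⟩ := Prod.mk.inj hs'
      exact neg_add_cancel _
    · intro h
      have hs : f * (s : MvPolynomial σ K) ∈ I := by
        rw [eq_neg_of_add_eq_zero_right h]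
        exact I.neg_mem a.2.2
      refine ⟨⟨s, s.2, hreg _ hs⟩, Prod.ext (Subtype.ext ?_) rfl⟩
      exact (eq_neg_of_add_eq_zero_left h).symm
  rw [← hrange, ← LinearMap.finrank_range_of_inj hinj, hker, LinearMap.finrank_range_add_finrank_ker,
    Module.finrank_prod]

theorem quotientHilbertSeries_sup_span [Finite σ] {I : Ideal (MvPolynomial σ K)}
    (hI : I.IsHomogeneous (homogeneousSubmodule σ K)) {f : MvPolynomial σ K} {e : ℕ}
    (hf : f.IsHomogeneous e) (hreg : ∀ x, f * x ∈ I → x ∈ I) :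
    quotientHilbertSeries (I ⊔ Ideal.span {f}) =
      (1 - PowerSeries.X ^ e) * quotientHilbertSeries I := by
  ext d
  rw [sub_mul, one_mul, map_sub, PowerSeries.coeff_X_pow_mul']
  simp only [quotientHilbertSeries, PowerSeries.coeff_mk]
  split_ifs with h
  · obtain ⟨m, rfl⟩ := Nat.exists_eq_add_of_le h
    have := finrank_homogeneousSubmodule_inf_sup_span hI hf hreg m
    rw [Nat.add_sub_cancel_left]
    omega
  · rw [homogeneousSubmodule_inf_sup_span_of_lt hI hf (not_le.mp h), sub_zero]

theorem quotientHilbertSeries_sup_ofList [Finite σ] {e : ℕ} {L : List (MvPolynomial σ K)}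
    (hL : ∀ f ∈ L, f.IsHomogeneous e) {I : Ideal (MvPolynomial σ K)}
    (hI : I.IsHomogeneous (homogeneousSubmodule σ K)) (hreg : IsRegularModulo I L) :
    quotientHilbertSeries (I ⊔ Ideal.ofList L) =
      (1 - PowerSeries.X ^ e) ^ L.length * quotientHilbertSeries I := by
  induction L generalizing I with
  | nil => simp
  | cons f L ih =>
    have hf := hL f (by simp)
    rw [Ideal.ofList_cons, ← sup_assoc, ih (fun g hg => hL g (by simp [hg])) (hI.sup ?_) hreg.2,
      quotientHilbertSeries_sup_span hI hf hreg.1, List.length_cons, pow_succ, mul_assoc]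
    exact Ideal.homogeneous_span _ _ fun g hg => ⟨e, by rwa [Set.mem_singleton_iff.mp hg]⟩

theorem finrank_homogeneousSubmodule [Fintype σ] (d : ℕ) :
    Module.finrank K (homogeneousSubmodule σ K d) = (Fintype.card σ + d - 1).choose d := by
  classical
  have hli : LinearIndependent K (fun m : (Finset.univ : Finset σ).finsuppAntidiag d =>
      monomial (R := K) (m : σ →₀ ℕ) 1) := by
    have := (basisMonomials σ K).linearIndependent.comp
      (fun m : (Finset.univ : Finset σ).finsuppAntidiag d => (m : σ →₀ ℕ)) Subtype.val_injective
    simpa [Function.comp_def] using this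
  have hspan : homogeneousSubmodule σ K d = Submodule.span K (Set.range
      (fun m : (Finset.univ : Finset σ).finsuppAntidiag d => monomial (R := K) (m : σ →₀ ℕ) 1)) := by
    refine le_antisymm (fun p hp => ?_) (Submodule.span_le.mpr ?_)
    · rw [p.as_sum]
      refine Submodule.sum_mem _ fun m hm => ?_
      have hdeg : m.degree = d := by
        by_contra h
        exact (mem_support_iff.mp hm) (IsHomogeneous.coeff_eq_zero hp h)
      have : monomial m (coeff m p) = coeff m p • monomial (R := K) m 1 := by
        rw [smul_monomial, smul_eq_mul, mul_one]
      rw [this]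
      refine Submodule.smul_mem _ _ (Submodule.subset_span ⟨⟨m, ?_⟩, rfl⟩)
      rw [Finset.mem_finsuppAntidiag]
      exact ⟨by rw [← hdeg, Finsupp.degree_eq_sum], Finset.subset_univ _⟩
    · rintro _ ⟨⟨m, hm⟩, rfl⟩
      rw [Finset.mem_finsuppAntidiag] at hm
      exact isHomogeneous_monomial 1 ((Finsupp.degree_eq_sum m).trans hm.1)
  rw [hspan, finrank_span_eq_card hli, Fintype.card_coe, Finset.card_finsuppAntidiag_nat_eq_choose,
    Finset.card_univ]

theorem one_sub_X_pow_mul_quotientHilbertSeries_bot (n : ℕ) :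
    (1 - PowerSeries.X) ^ (n + 1) *
      quotientHilbertSeries (⊥ : Ideal (MvPolynomial (Fin (n + 1)) K)) = 1 := by
  rw [mul_comm]
  refine Eq.trans ?_ (PowerSeries.mk_add_choose_mul_one_sub_pow_eq_one ℤ n)
  congr 1
  ext d
  simp only [quotientHilbertSeries, PowerSeries.coeff_mk]
  have : (⊥ : Ideal (MvPolynomial (Fin (n + 1)) K)).restrictScalars K = ⊥ := rfl
  rw [this, inf_bot_eq, finrank_bot, finrank_homogeneousSubmodule, Fintype.card_fin,
    Nat.cast_zero, sub_zero, Nat.add_right_comm, Nat.add_sub_cancel, ← Nat.choose_symm_add]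

/-- A complete intersection of `n + 1` quadrics in `n + 1` variables has the Hilbert series
`(1 - X ^ 2) ^ (n + 1) / (1 - X) ^ (n + 1)`. -/
theorem quotientHilbertSeries_ofList_quadrics {n : ℕ}
    {L : List (MvPolynomial (Fin (n + 1)) K)} (hL : ∀ f ∈ L, f.IsHomogeneous 2)
    (hlen : L.length = n + 1) (hreg : IsRegularModulo ⊥ L) :
    quotientHilbertSeries (Ideal.ofList L) = (1 + PowerSeries.X) ^ (n + 1) := by
  have h := quotientHilbertSeries_sup_ofList hL (Ideal.IsHomogeneous.bot _) hreg
  rw [bot_sup_eq, hlen] at h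
  rw [h]
  have : (1 - PowerSeries.X ^ 2 : PowerSeries ℤ) = (1 + PowerSeries.X) * (1 - PowerSeries.X) := by
    ring
  rw [this, mul_pow, mul_assoc, one_sub_X_pow_mul_quotientHilbertSeries_bot, mul_one]

theorem homogeneousSubmodule_le_iff_coeff_quotientHilbertSeries [Finite σ]
    (I : Ideal (MvPolynomial σ K)) (d : ℕ) :
    homogeneousSubmodule σ K d ≤ I.restrictScalars K ↔
      PowerSeries.coeff d (quotientHilbertSeries I) = 0 := by
  rw [quotientHilbertSeries, PowerSeries.coeff_mk, sub_eq_zero, Nat.cast_inj]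
  constructor
  · intro h
    rw [inf_eq_left.mpr h]
  · intro h
    exact inf_eq_left.mp (Submodule.eq_of_le_of_finrank_eq inf_le_left h.symm)

end Hilbert

end MvPolynomial

/-! ### Complete intersections of quadrics -/

theorem linearIndependent_of_prod_ne_zero {ι K R : Type*} [Fintype ι] [Field K] [CommRing R]
    [Algebra K R] {v : ι → R} (hsq : ∀ i, v i ^ 2 = 0) (hprod : ∏ i, v i ≠ 0) :
    LinearIndependent K v := by
  classical
  rw [Fintype.linearIndependent_iff]
  intro c hc i
  have h : (∑ j, c j • v j) * ∏ j ∈ Finset.univ.erase i, v j = c i • ∏ j, v j := by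
    rw [Finset.sum_mul, Finset.sum_eq_single i]
    · rw [smul_mul_assoc, Finset.mul_prod_erase _ _ (Finset.mem_univ i)]
    · intro j _ hj
      rw [smul_mul_assoc, ← Finset.mul_prod_erase _ _ (Finset.mem_erase.mpr ⟨hj, Finset.mem_univ j⟩),
        ← mul_assoc, ← pow_two, hsq, zero_mul, smul_zero]
    · simp
  rw [hc, zero_mul] at h
  exact (smul_eq_zero.mp h.symm).resolve_right hprod

section CompleteIntersection

open MvPolynomial

variable {K R : Type*} [Field K] [CommRing R] [Algebra K R] {𝒜 : ℕ → Submodule K R} {n : ℕ}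

theorem IsCompleteIntersectionSAGA.prod_ne_zero (h2 : (2 : K) ≠ 0)
    (hR : IsCompleteIntersectionSAGA 𝒜 n 2) {k : ℕ} (t : Fin k → 𝒜 1) (ht : ∀ i, t i ≠ 0)
    (hsq : ∀ i, (t i : R) ^ 2 = 0)
    (hinj : Function.Injective fun i => Projectivization.mk K (t i) (ht i)) :
    ∏ i, (t i : R) ≠ 0 := by
  obtain ⟨g, φ, hg, hreg, -, hker, h𝒜⟩ := hR
  have hmem : ∀ p, φ p = 0 ↔ p ∈ Ideal.ofList ([] ++ List.ofFn g) := by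
    intro p
    rw [List.nil_append, Ideal.ofList_ofFn, ← hker, RingHom.mem_ker]
  have hlift : ∀ i, ∃ T : MvPolynomial (Fin (n + 1)) K, T.IsHomogeneous 1 ∧ φ T = t i := by
    intro i
    exact (h𝒜 1).le (t i).2
  choose T hT hφT using hlift
  have hprod : ∏ i, (t i : R) = φ (List.ofFn T).prod := by
    rw [List.prod_ofFn, map_prod]
    exact Finset.prod_congr rfl fun i _ => (hφT i).symm
  rw [hprod, Ne, hmem]
  refine prod_notMem_ofList h2 (List.ofFn T) (by simp) (List.forall_mem_ofFn_iff.mpr hg)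
    hreg.toIsWeaklyRegular.isRegularModulo (List.forall_mem_ofFn_iff.mpr hT) ?_ ?_ ?_
  · intro q hq hq0
    obtain ⟨i, rfl⟩ := List.mem_ofFn.mp hq
    have hTi : T i = 0 := by simpa using hq0
    refine ht i (Subtype.ext ?_)
    rw [← hφT i, hTi, map_zero, ZeroMemClass.coe_zero]
  · rw [List.pairwise_ofFn]
    intro i j hij hmem'
    have hset : {f | f ∈ [T i]} = {T i} := by ext; simp
    rw [hset] at hmem'
    obtain ⟨c, hc⟩ := Submodule.mem_span_singleton.mp hmem'
    refine hij.ne' (hinj ((Projectivization.mk_eq_mk_iff' K _ _ _ _).mpr ⟨c, Subtype.ext ?_⟩))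
    rw [Submodule.coe_smul, ← hφT i, ← hφT j, ← hc, map_smul]
  · intro q hq
    obtain ⟨i, rfl⟩ := List.mem_ofFn.mp hq
    rw [← hmem, map_pow, hφT, hsq]

theorem IsCompleteIntersectionSAGA.eq_bot_iff_choose_eq_zero
    (hR : IsCompleteIntersectionSAGA 𝒜 n 2) (d : ℕ) : 𝒜 d = ⊥ ↔ (n + 1).choose d = 0 := by
  obtain ⟨g, φ, hg, hreg, -, hker, h𝒜⟩ := hR
  have hI : RingHom.ker φ = Ideal.ofList (List.ofFn g) := by rw [hker, Ideal.ofList_ofFn]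
  have h := homogeneousSubmodule_le_iff_coeff_quotientHilbertSeries (Ideal.ofList (List.ofFn g)) d
  rw [quotientHilbertSeries_ofList_quadrics (List.forall_mem_ofFn_iff.mpr hg) (List.length_ofFn)
    hreg.toIsWeaklyRegular.isRegularModulo] at h
  have hcoeff : PowerSeries.coeff d ((1 + PowerSeries.X : PowerSeries ℤ) ^ (n + 1)) =
      (n + 1).choose d := by
    have : (1 + PowerSeries.X : PowerSeries ℤ) ^ (n + 1) =
        ((1 + Polynomial.X : Polynomial ℤ) ^ (n + 1) : Polynomial ℤ) := by simp
    rw [this, Polynomial.coeff_coe, Polynomial.coeff_one_add_X_pow]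
  rw [hcoeff, Nat.cast_eq_zero, ← hI] at h
  rw [← h, h𝒜, eq_bot_iff, Submodule.map_le_iff_le_comap]
  rfl

theorem IsCompleteIntersectionSAGA.isSocleDegree (hR : IsCompleteIntersectionSAGA 𝒜 n 2) :
    IsSocleDegree 𝒜 (n + 1) := by
  refine ⟨?_, fun d hd => (hR.eq_bot_iff_choose_eq_zero d).mpr (Nat.choose_eq_zero_of_lt hd)⟩
  rw [Ne, hR.eq_bot_iff_choose_eq_zero, Nat.choose_self]
  exact one_ne_zero

end CompleteIntersection

theorem proposition2p1 {K R : Type*} [Field K] [IsAlgClosed K] [CharZero K]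
    [CommRing R] [Algebra K R] (𝒜 : ℕ → Submodule K R) [GradedAlgebra 𝒜]
    (n : ℕ) (hR : IsCompleteIntersectionSAGA 𝒜 n 2) :
    (∀ (k : ℕ) (t : Fin k → 𝒜 1) (ht : ∀ i, t i ≠ 0),
      (∀ i, Projectivization.mk K (t i) (ht i) ∈ nilpotentLocus 𝒜 1 2) →
      Function.Injective (fun i => Projectivization.mk K (t i) (ht i)) →
      ∏ i, (t i : R) ≠ 0 ∧ LinearIndependent K t) ∧
    (nilpotentLocus 𝒜 1 2).encard ≤ n + 1 ∧
    IsSocleDegree 𝒜 (n + 1) := by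
  refine ⟨fun k t ht hmem hinj => ?_, ?_, hR.isSocleDegree⟩
  · have hsq : ∀ i, (t i : R) ^ 2 = 0 := fun i =>
      (mk_mem_nilpotentLocus 𝒜 1 2 (t i) (ht i)).mp (hmem i)
    have hprod := hR.prod_ne_zero two_ne_zero t ht hsq hinj
    exact ⟨hprod, LinearIndependent.of_comp (𝒜 1).subtype
      (linearIndependent_of_prod_ne_zero (K := K) hsq hprod)⟩
  · -- `n + 2` distinct points would have a nonzero product in degree `n + 2`
    by_contra! hlt
    have hle : ((n + 2 : ℕ) : ℕ∞) ≤ (nilpotentLocus 𝒜 1 2).encard := by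
      have := Order.add_one_le_of_lt hlt
      exact_mod_cast this
    obtain ⟨s, hs, hcard⟩ := Set.exists_subset_encard_eq hle
    have hfin : s.Finite := Set.finite_of_encard_eq_coe hcard
    have := hfin.fintype
    have hcard' : Fintype.card s = n + 2 := by
      rw [← Set.coe_fintypeCard] at hcard
      exact_mod_cast hcard
    let e := (Fintype.equivFinOfCardEq hcard').symm
    have hmk : ∀ i, Projectivization.mk K (e i).1.rep (e i).1.rep_nonzero = (e i).1 :=
      fun i => Projectivization.mk_rep _
    refine hR.prod_ne_zero two_ne_zero (fun i => (e i).1.rep) (fun i => (e i).1.rep_nonzero)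
      (fun i => hs (e i).2) ?_ ?_
    · intro i j hij
      simp only [hmk] at hij
      exact e.injective (Subtype.ext hij)
    · have hdeg : ∏ i, ((e i).1.rep : R) ∈ 𝒜 (∑ _i : Fin (n + 2), 1) :=
        SetLike.prod_mem_graded 𝒜 _ _ fun i _ => (e i).1.rep.2
      rw [hR.isSocleDegree.2 _ (by simp)] at hdeg
      exact hdeg
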